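/- For a prime power $q$ and integers $0\le c<k<n$, a $c$-intersecting equidistant code is a set $\mathcal C$, with at least two elements, of $k$-dimensional subspaces of $\mathbb F_q^n$ such that $\dim(U\cap V)=c$ for all distinct $U,V\in\mathcal C$. Let $e_q(k,n,c)$ be the largest cardinality of such a code. Let $0\le c\le k-1$ and $n\ge 3k-1$ be integers, and write $n-c=h(k-c)+r$ with $0\le r\le k-c-1$ (so $h\ge 2$). For monic irreducible polynomials $p,p'\in\mathbb F_q[x]$ of degrees $k-c$ and $k-c+r$, with companion matrices $P$ and $P'$, let $\mathcal F_q(k,n,c,p,p')$ be the sunflower code, that is, the set of subspaces of $\mathbb F_q^n$ consisting of the rowspaces of all $k\times n$ matrices $$\begin{bmatrix} I_c & 0 & \cdots & 0 & 0 & 0 & \cdots & 0 & 0\\ 0 & 0_{k-c} & \cdots & 0_{k-c} & I_{k-c} & A_{i+1} & \cdots & A_{h-1} & A_{[k-c]}\end{bmatrix}$$ with $1\le i\le h-1$, with $i-1$ blocks $0_{k-c}$ before $I_{k-c}$, with $A_{i+1},\dots,A_{h-1}\in\mathbb F_q[P]$, and with $A_{[k-c]}$ the last $k-c$ rows of a matrix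 $A\in\mathbb F_q[P']$, together with the rowspace of $$\begin{bmatrix} I_c & 0 & 0\\ 0 & 0_{(k-c)\times(n-k)} & I_{k-c}\end{bmatrix}.$$ The companion matrix of $x^s+\sum_{i<s}p_ix^i$ is the $s\times s$ matrix with ones directly above the diagonal, last row $(-p_0,\dots,-p_{s-1})$, and zeros elsewhere. Then there is $q_0$, depending only on $k,n,c$, such that for every prime power $q\ge q_0$ and all $p,p'$ as above $$e_q(k,n,c)-|\mathcal F_q(k,n,c,p,p')|\le q^r-1 .$$ In particular, for every choice of $p,p'$ for each prime power $q$, $$\lim_{q\to\infty}\frac{|\mathcal F_q(k,n,c,p,p')|}{e_q(k,n,c)}=1 .$$ -/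

import Mathlib

open Filter Topology Polynomial

/-- The set `𝒢_q(k, n)` of `k`-dimensional vector subspaces of `F ^ n`, where `F` is the field with
`q` elements. -/
def subspacesOfDim (F : Type*) [Field F] (k n : ℕ) : Set (Submodule F (Fin n → F)) :=
  {U | Module.finrank F U = k}

/-- The subspace distance `d(U, V) = dim U + dim V - 2 dim (U ∩ V)`.
The subtraction never truncates, since `dim (U ∩ V)` is at most `dim U` and at most `dim V`. -/
noncomputable def subspaceDist {F : Type*} [Field F] {n : ℕ} (U V : Submodule F (Fin n → F)) : ℕ :=
  Module.finrank F U + Module.finrank F V - 2 * Module.finrank F (U ⊓ V : Submodule F (Fin n → F))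

/-- A subspace code of constant dimension `k`: a set of `k`-dimensional subspaces of `F ^ n`
with at least two elements. -/
def IsSubspaceCode {F : Type*} [Field F] {n : ℕ} (k : ℕ) (C : Set (Submodule F (Fin n → F))) :
    Prop :=
  C ⊆ subspacesOfDim F k n ∧ C.Nontrivial

/-- The minimum distance of a code. -/
noncomputable def minSubspaceDist {F : Type*} [Field F] {n : ℕ}
    (C : Set (Submodule F (Fin n → F))) : ℕ :=
  sInf {d | ∃ U ∈ C, ∃ V ∈ C, U ≠ V ∧ subspaceDist U V = d}

/-- A code is equidistant if any two distinct codewords are at distance `d(C)`. -/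
def IsEquidistant {F : Type*} [Field F] {n : ℕ} (C : Set (Submodule F (Fin n → F))) : Prop :=
  ∀ U ∈ C, ∀ V ∈ C, U ≠ V → subspaceDist U V = minSubspaceDist C

/-- An equidistant `c`-intersecting subspace code of constant dimension `k` (with `c ≤ k`). -/
def IsIntersectingCode {F : Type*} [Field F] {n : ℕ} (k c : ℕ)
    (C : Set (Submodule F (Fin n → F))) : Prop :=
  IsSubspaceCode k C ∧ IsEquidistant C ∧ minSubspaceDist C = 2 * (k - c)

/-- `e_q(k, n, c)`: the largest cardinality of an equidistant `c`-intersecting code of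
`k`-dimensional subspaces of `F ^ n`, where `F` is the finite field with `q` elements. -/
noncomputable def maxIntersectingCard (F : Type*) [Field F] (k n c : ℕ) : ℕ :=
  sSup {N | ∃ C : Set (Submodule F (Fin n → F)), IsIntersectingCode k c C ∧ C.ncard = N}

/-- Over a finite field the set whose supremum is taken in `maxIntersectingCard` is bounded. -/
theorem bddAbove_intersectingCard (F : Type*) [Field F] [Finite F] (k n c : ℕ) :
    BddAbove {N | ∃ C : Set (Submodule F (Fin n → F)), IsIntersectingCode k c C ∧ C.ncard = N} := by
  refine ⟨Nat.card (Submodule F (Fin n → F)), ?_⟩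
  rintro N ⟨C, -, rfl⟩
  exact Set.ncard_le_card C

/-- The companion matrix of a monic polynomial `p = x ^ s + ∑ i < s, p_i x ^ i` of degree `s`:
ones just above the diagonal, last row `-p_0, …, -p_{s-1}`, zeros elsewhere. -/
def companionMatrix {F : Type*} [Field F] (s : ℕ) (p : F[X]) : Matrix (Fin s) (Fin s) F :=
  Matrix.of fun a b =>
    if (a : ℕ) + 1 = s then -p.coeff b else if (a : ℕ) + 1 = (b : ℕ) then 1 else 0

/-- The rowspace of a matrix. -/
def rowsp {F : Type*} [Field F] {R : Type*} {n : ℕ} (M : Matrix R (Fin n) F) :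
    Submodule F (Fin n → F) :=
  Submodule.span F (Set.range M.row)

/-- The splitting of the `c + (m * s + (r + s))` columns, from left to right, into one block of
width `c`, then `m` blocks of width `s`, then one block of width `r + s`. -/
def columnBlocks (c s m r : ℕ) :
    Fin c ⊕ ((Fin m × Fin s) ⊕ Fin (r + s)) ≃ Fin (c + (m * s + (r + s))) :=
  ((Equiv.refl (Fin c)).sumCongr
      ((finProdFinEquiv.sumCongr (Equiv.refl (Fin (r + s)))).trans finSumFinEquiv)).trans
    finSumFinEquiv

/-- The last `s` rows of a matrix with `r + s` rows. -/
def lastRows {F : Type*} {r s : ℕ} (A : Matrix (Fin (r + s)) (Fin (r + s)) F) :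
    Matrix (Fin s) (Fin (r + s)) F :=
  A.submatrix (Fin.natAdd r) id

/-- The `(c + s) × (c + m * s + (r + s))` block matrix
`[I_c 0 ⋯ 0 0; 0 N_0 ⋯ N_{m-1} L]`, where the `N_j` are `s × s` and `L` is `s × (r + s)`. -/
def sunflowerMatrix {F : Type*} [Field F] {c s m r : ℕ} (N : Fin m → Matrix (Fin s) (Fin s) F)
    (L : Matrix (Fin s) (Fin (r + s)) F) :
    Matrix (Fin c ⊕ Fin s) (Fin (c + (m * s + (r + s)))) F :=
  (Matrix.fromBlocks 1 0 0
    (Matrix.fromCols (Matrix.of fun a (jb : Fin m × Fin s) => N jb.1 a jb.2) L)).submatrix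
      id (columnBlocks c s m r).symm

/-- The codewords of the sunflower code, where `m = h - 1` is the number of square blocks:
the rowspaces of the matrices `[I_c 0 ⋯ 0; 0 0 ⋯ 0 I_s A_{i+1} ⋯ A_{m-1} A']`, with `i < m`
zero blocks before the block `I_s`, where `A_j ∈ F[P]` and `A'` consists of the last `s` rows of a
matrix in `F[P']`, and the rowspace of `[I_c 0 ⋯ 0 0; 0 0 ⋯ 0 I_s]`, in which `I_s` occupies the
last `s` columns (its last block `[0 I_s]` of width `r + s` is the last `s` rows of `I_{r+s}`).
Here `P` and `P'` are the companion matrices of `p` and `p'`, of sizes `s` and `r + s`. -/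
def sunflowerCodeBlocks {F : Type*} [Field F] (c s m r : ℕ) (p p' : F[X]) :
    Set (Submodule F (Fin (c + (m * s + (r + s))) → F)) :=
  {U | ∃ (i : Fin m) (A : Fin m → Matrix (Fin s) (Fin s) F)
      (A' : Matrix (Fin (r + s)) (Fin (r + s)) F),
      (∀ j, A j ∈ Algebra.adjoin F {companionMatrix s p}) ∧
      A' ∈ Algebra.adjoin F {companionMatrix (r + s) p'} ∧
      U = rowsp (sunflowerMatrix (c := c)
        (fun j => if j < i then 0 else if j = i then 1 else A j) (lastRows A'))} ∪
  {rowsp (sunflowerMatrix (c := c) (fun _ => 0) (lastRows 1))}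

/-- The number of columns in the construction is `n`, where `n - c = h (k - c) + r`. -/
theorem sunflower_columns {k n c : ℕ} (hc : c < k) (hn : 2 * k ≤ n + c) :
    c + (((n - c) / (k - c) - 1) * (k - c) + ((n - c) % (k - c) + (k - c))) = n := by
  have h1 : 1 ≤ (n - c) / (k - c) := by
    rw [Nat.one_le_div_iff (by omega)]
    omega
  obtain ⟨h, hh⟩ : ∃ h, (n - c) / (k - c) = h + 1 := ⟨_, (Nat.sub_add_cancel h1).symm⟩
  have h2 := Nat.div_add_mod (n - c) (k - c)
  rw [hh] at h2 ⊢
  have h3 : (k - c) * (h + 1) = h * (k - c) + (k - c) := by ring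
  simp only [Nat.add_sub_cancel]
  omega

/-- The sunflower code `ℱ_q(k, n, c, p, p')` in `F ^ n`, where `F` is the field with `q` elements:
write `n - c = h (k - c) + r` with `0 ≤ r < k - c` and take `s = k - c`, `m = h - 1` above.
It is meant for monic irreducible `p`, `p'` of degrees `k - c` and `k - c + r`. -/
def sunflowerCode {F : Type*} [Field F] {k n c : ℕ} (hc : c < k) (hn : 2 * k ≤ n + c)
    (p p' : F[X]) : Set (Submodule F (Fin n → F)) :=
  Submodule.map
      (LinearEquiv.funCongrLeft F F (finCongr (sunflower_columns hc hn).symm)).toLinearMap ''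
    sunflowerCodeBlocks c (k - c) ((n - c) / (k - c) - 1) ((n - c) % (k - c)) p p'

/-! Write `Q = q ^ (k - c)`. A large code is forced to be a sunflower: all its members contain one
`c`-dimensional subspace. The parts of the members outside this kernel are disjoint, and counting
vectors gives `e * (Q - 1) ≤ q ^ (n - c) - 1`.

The kernel comes from a variance argument (`degree_mul_codegree_le`): a nonzero vector in `d`
members and outside `e` of them satisfies `(q - 1) * d * e ≤ (q ^ k - q ^ c) * (d + e)`, so it lies
in few members or misses few. The vectors that miss few span the kernel (`exists_sunflower_kernel`).
This works for codes with more than `q ^ (2 * k - 1)` members. Smaller codes are harmless: the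
construction has at least `q ^ (n - k)` words, and `n ≥ 3 * k - 1`.

In the construction, `F[P]` and `F[P']` are fields, so differences of distinct blocks are invertible
and the words, cut down to the last `n - c` coordinates, meet trivially. Its size `f` satisfies `f *
(Q - 1) = Q - 1 + q ^ (n - c) - q ^ r * Q`. Comparison with the packing bound gives `(e - f) * (Q -
1) ≤ (q ^ r - 1) * Q`, and since `q ^ r < Q`, integrality yields `e - f ≤ q ^ r - 1`. -/

/-! ### Large equidistant codes are sunflowers. -/

section Sunflower

open Finset Module

/-- The second moment of a weighted sum of indicator functions of sets of the same size `a`, any two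
of which meet in `b` points. -/
theorem sum_sq_weighted_indicator {E ι : Type*} [Fintype E] [DecidableEq E] [DecidableEq ι]
    (C : Finset ι) (S : ι → Finset E) (w : ι → ℤ) (a b : ℤ)
    (ha : ∀ i ∈ C, (#(S i) : ℤ) = a)
    (hb : ∀ i ∈ C, ∀ j ∈ C, i ≠ j → (#(S i ∩ S j) : ℤ) = b) :
    ∑ y, (∑ i ∈ C, if y ∈ S i then w i else 0) ^ 2 =
      b * (∑ i ∈ C, w i) ^ 2 + (a - b) * ∑ i ∈ C, w i ^ 2 := by
  have key : ∀ i ∈ C, ∀ j ∈ C,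
      ∑ y, (if y ∈ S i then w i else 0) * (if y ∈ S j then w j else 0) =
        b * (w i * w j) + if i = j then (a - b) * w i ^ 2 else 0 := by
    intro i hi j hj
    have h1 : ∀ y, (if y ∈ S i then w i else 0) * (if y ∈ S j then w j else 0) =
        if y ∈ S i ∩ S j then w i * w j else 0 := by
      intro y
      by_cases h : y ∈ S i <;> by_cases h' : y ∈ S j <;> simp [h, h']
    simp only [h1, Finset.sum_ite_mem, Finset.univ_inter, Finset.sum_const, nsmul_eq_mul]
    split_ifs with hij
    · subst hij
      rw [Finset.inter_self, ha i hi]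
      ring
    · rw [hb i hi j hj hij]
      ring
  simp only [sq (∑ i ∈ C, _), Finset.sum_mul_sum]
  rw [Finset.sum_comm]
  simp only [Finset.sum_comm (s := Finset.univ)]
  rw [Finset.sum_congr rfl fun i hi => Finset.sum_congr rfl fun j hj => key i hi j hj]
  simp +contextual [Finset.sum_add_distrib, Finset.mul_sum]

variable {F E : Type*} [Field F] [Finite F] [AddCommGroup E] [Module F E] [Finite E]

open Classical in
/-- In a family of subspaces with `a` elements, any two meeting in `b` elements, a nonzero vector
lies in `d` members where `d (M - d)` is small. -/
theorem degree_mul_codegree_le (C : Finset (Submodule F E)) {a b : ℤ} (hab : b ≤ a)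
    (ha : ∀ A ∈ C, (Nat.card A : ℤ) = a)
    (hb : ∀ A ∈ C, ∀ B ∈ C, A ≠ B → (Nat.card (A ⊓ B : Submodule F E) : ℤ) = b)
    {x : E} (hx : x ≠ 0) :
    ((Nat.card F : ℤ) - 1) * (#{A ∈ C | x ∈ A} * #{A ∈ C | x ∉ A}) ≤ (a - b) * #C := by
  have := Fintype.ofFinite E
  have := Fintype.ofFinite F
  set d : ℤ := Nat.cast #{A ∈ C | x ∈ A} with hd
  set e : ℤ := Nat.cast #{A ∈ C | x ∉ A} with he
  have hde : d + e = #C := by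
    rw [hd, he]
    exact_mod_cast Finset.card_filter_add_card_filter_not (s := C) (fun A => x ∈ A)
  have hd0 : 0 ≤ d := by positivity
  have he0 : 0 ≤ e := by positivity
  let S : Submodule F E → Finset E := fun A => {y | y ∈ A}
  have hS : ∀ A : Submodule F E, #(S A) = Nat.card A := by
    intro A
    rw [Nat.card_eq_fintype_card, Fintype.card_subtype]
  -- These weights have total zero, which removes the `b` term from the second moment.
  let w : Submodule F E → ℤ := fun A => if x ∈ A then e else -d
  have hsum := sum_sq_weighted_indicator C S w a b (fun A hA => by rw [hS, ha A hA])
    (fun A hA B hB hAB => by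
      rw [← hb A hA B hB hAB, ← hS]
      congr 2
      ext y
      simp [S])
  have hw : ∑ A ∈ C, w A = 0 := by
    simp only [w, Finset.sum_ite, Finset.sum_const, nsmul_eq_mul, ← hd, ← he]
    ring
  have hw2 : ∑ A ∈ C, w A ^ 2 = d * e * #C := by
    simp only [w, ite_pow, Finset.sum_ite, Finset.sum_const, nsmul_eq_mul, ← hd, ← he, ← hde]
    ring
  rw [hw, hw2] at hsum
  let g : E → ℤ := fun y => ∑ A ∈ C, if y ∈ S A then w A else 0
  -- A subspace contains all nonzero multiples of `x` or none, so `q - 1` points each contribute `(d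
  -- * e) ^ 2`.
  have hg : ∀ t : F, t ≠ 0 → g (t • x) = d * e := by
    intro t ht
    have : ∀ A : Submodule F E, (if t • x ∈ S A then w A else 0) = if x ∈ A then e else 0 := by
      intro A
      by_cases h : x ∈ A <;> simp [S, w, Submodule.smul_mem_iff _ ht, h]
    rw [show g (t • x) = ∑ A ∈ C, if x ∈ A then e else 0 from
      Finset.sum_congr rfl fun A _ => this A]
    simp only [Finset.sum_ite, Finset.sum_const, nsmul_eq_mul, ← hd]
    ring
  have hle : ∑ t ∈ (Finset.univ : Finset F).erase 0, g (t • x) ^ 2 ≤ ∑ y, g y ^ 2 := by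
    rw [← Finset.sum_image (f := fun y => g y ^ 2) (g := fun t : F => t • x)]
    · exact Finset.sum_le_univ_sum_of_nonneg fun y => sq_nonneg _
    · intro t _ t' _ h
      exact smul_left_injective F hx h
  rw [Finset.sum_congr rfl fun t ht => by rw [hg t (Finset.ne_of_mem_erase ht)], Finset.sum_const,
    Finset.card_erase_of_mem (Finset.mem_univ _), Finset.card_univ, nsmul_eq_mul,
    Nat.cast_sub Fintype.card_pos, ← Nat.card_eq_fintype_card] at hle
  rcases (mul_nonneg hd0 he0).eq_or_lt with h0 | h0
  · rw [← h0, mul_zero]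
    exact mul_nonneg (sub_nonneg.2 hab) (by positivity)
  · have : (d * e) * (((Nat.card F : ℤ) - 1) * (d * e)) ≤ (d * e) * ((a - b) * #C) := by
      push_cast at hle
      calc _ = ((Nat.card F : ℤ) - 1) * (d * e) ^ 2 := by ring
        _ ≤ _ := hle
        _ = _ := hsum
        _ = _ := by ring
    exact le_of_mul_le_mul_left this h0

open Classical in
/-- A nonzero vector lies in few or in almost all members of an equidistant code. -/
theorem degree_le_or_codegree_le (C : Finset (Submodule F E)) {k c : ℕ} (hck : c < k)
    (hk : ∀ A ∈ C, finrank F A = k)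
    (hc : ∀ A ∈ C, ∀ B ∈ C, A ≠ B → finrank F (A ⊓ B : Submodule F E) = c)
    {x : E} (hx : x ≠ 0) :
    #{A ∈ C | x ∈ A} ≤ 4 * Nat.card F ^ (k - 1) ∨ #{A ∈ C | x ∉ A} ≤ 4 * Nat.card F ^ (k - 1) := by
  have hq : 2 ≤ Nat.card F := Finite.one_lt_card
  have hab : (Nat.card F : ℤ) ^ c ≤ (Nat.card F : ℤ) ^ k :=
    pow_le_pow_right₀ (by exact_mod_cast (by omega : 1 ≤ Nat.card F)) hck.le
  have h := degree_mul_codegree_le C hab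
    (fun A hA => by rw [natCard_eq_pow_finrank (K := F), hk A hA]; push_cast; rfl)
    (fun A hA B hB hAB => by
      rw [natCard_eq_pow_finrank (K := F), hc A hA B hB hAB]; push_cast; rfl) hx
  have hde := Finset.card_filter_add_card_filter_not (s := C) (fun A => x ∈ A)
  obtain ⟨j, rfl⟩ : ∃ j, k = j + 1 := ⟨k - 1, by omega⟩
  rw [Nat.add_sub_cancel]
  generalize #{A ∈ C | x ∈ A} = d at *
  generalize #{A ∈ C | x ∉ A} = e at *
  generalize #C = M at *
  subst hde
  by_contra! hcon
  obtain ⟨h1, h2⟩ := hcon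
  zify at h1 h2 hq
  generalize (Nat.card F : ℤ) = q at *
  have hT : 0 < q ^ j := by positivity
  have hc0 : 0 < q ^ c := by positivity
  set T := q ^ j
  have hd : (0 : ℤ) < d := by linarith
  have he : (0 : ℤ) < e := by linarith
  -- Here `q ^ (j + 1) ≤ 2 * (q - 1) * q ^ j`, because `q ≥ 2`.
  have h3 : (q - 1) * (d * e) ≤ (q - 1) * (2 * T * (d + e)) := by
    refine h.trans ?_
    push_cast
    rw [← mul_assoc]
    refine mul_le_mul_of_nonneg_right ?_ (by positivity)
    rw [pow_succ]
    nlinarith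
  have h4 := le_of_mul_le_mul_left h3 (by linarith)
  -- Adding `d * (e - 4 * T) > 0` and `e * (d - 4 * T) > 0` gives `d * e > 2 * T * (d + e)`.
  nlinarith [mul_pos hd (sub_pos.2 h2), mul_pos he (sub_pos.2 h1)]

omit [Finite F] in
open Classical in
/-- Double counting of the incidences between the vectors of `A` and the members of `C`. -/
theorem sum_degree_eq (C : Finset (Submodule F E)) {k c : ℕ}
    (hk : ∀ A ∈ C, finrank F A = k)
    (hc : ∀ A ∈ C, ∀ B ∈ C, A ≠ B → finrank F (A ⊓ B : Submodule F E) = c)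
    [Fintype E] {A : Submodule F E} (hA : A ∈ C) :
    ∑ x : E with x ∈ A, #{B ∈ C | x ∈ B} = Nat.card F ^ k + (#C - 1) * Nat.card F ^ c := by
  have h1 : ∀ B : Submodule F E, #{x : E | x ∈ A ∧ x ∈ B} =
      Nat.card F ^ finrank F (A ⊓ B : Submodule F E) := by
    intro B
    rw [← natCard_eq_pow_finrank (K := F), Nat.card_eq_fintype_card, Fintype.card_subtype]
    simp [Submodule.mem_inf]
  have h2 : ∑ x : E with x ∈ A, #{B ∈ C | x ∈ B} =
      ∑ B ∈ C, Nat.card F ^ finrank F (A ⊓ B : Submodule F E) := by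
    simp only [← h1, ← Finset.filter_filter]
    exact Finset.sum_card_bipartiteAbove_eq_sum_card_bipartiteBelow (fun x B => x ∈ B)
  rw [h2, ← Finset.add_sum_erase C _ hA, inf_idem, hk A hA,
    Finset.sum_congr rfl fun B hB => by
      rw [hc A hA B (Finset.mem_of_mem_erase hB) (Finset.ne_of_mem_erase hB).symm]]
  rw [Finset.sum_const, Finset.card_erase_of_mem hA, smul_eq_mul]

open Classical in
/-- A large equidistant code is a sunflower: its members share a `c`-dimensional subspace. -/
theorem exists_sunflower_kernel (C : Finset (Submodule F E)) {k c : ℕ} (hck : c < k)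
    (hk : ∀ A ∈ C, finrank F A = k)
    (hc : ∀ A ∈ C, ∀ B ∈ C, A ≠ B → finrank F (A ⊓ B : Submodule F E) = c)
    (hq : 4 * finrank F E + 9 ≤ Nat.card F) (hM : Nat.card F ^ (2 * k - 1) < #C) :
    ∃ H : Submodule F E, finrank F H = c ∧ ∀ A ∈ C, H ≤ A := by
  have := Fintype.ofFinite E
  obtain ⟨j, rfl⟩ : ∃ j, k = j + 1 := ⟨k - 1, by omega⟩
  have hdich := fun x (hx : x ≠ 0) => degree_le_or_codegree_le C hck hk hc (x := x) hx
  rw [Nat.add_sub_cancel] at hdich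
  rw [show 2 * (j + 1) - 1 = 2 * j + 1 by omega] at hM
  set q := Nat.card F with hqdef
  set T := 4 * q ^ j with hT
  have hqj : 1 ≤ q ^ j := Nat.one_le_pow _ _ (by omega)
  let high : Set E := {x | #{A ∈ C | x ∉ A} ≤ T}
  let H := Submodule.span F high
  have hlow : ∀ x, x ∉ H → #{A ∈ C | x ∈ A} ≤ T := by
    intro x hx
    have hx0 : x ≠ 0 := fun h => hx (h ▸ H.zero_mem)
    exact (hdich x hx0).resolve_right fun h => hx (Submodule.subset_span h)
  obtain ⟨b, hbH, hbspan, hbli⟩ := exists_linearIndependent F high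
  have hbfin : b.Finite := Set.toFinite b
  have hbcard : #hbfin.toFinset ≤ finrank F E := by
    have := Fintype.ofFinite b
    have h := hbli.fintype_card_le_finrank
    rwa [← Nat.card_eq_fintype_card, Nat.card_coe_set_eq, Set.ncard_eq_toFinset_card b hbfin] at h
  -- A member not containing `H` misses one of at most `finrank F E` spanning vectors, each missed
  -- by at most `T` members.
  have hmiss : #{A ∈ C | ¬ H ≤ A} ≤ finrank F E * T := by
    have hsub : {A ∈ C | ¬ H ≤ A} ⊆ hbfin.toFinset.biUnion fun x => {A ∈ C | x ∉ A} := by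
      intro A hA
      rw [Finset.mem_filter, show H = Submodule.span F b from hbspan.symm, Submodule.span_le,
        Set.not_subset] at hA
      obtain ⟨hAC, x, hxb, hxA⟩ := hA
      exact Finset.mem_biUnion.2 ⟨x, hbfin.mem_toFinset.2 hxb, Finset.mem_filter.2 ⟨hAC, hxA⟩⟩
    refine (Finset.card_le_card hsub).trans ((Finset.card_biUnion_le_card_mul _ _ T ?_).trans
      (Nat.mul_le_mul_right T hbcard))
    intro x hx
    exact hbH (hbfin.mem_toFinset.1 hx)
  have hpow : q * q ^ j ≤ q ^ (2 * j + 1) := by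
    rw [← pow_succ']
    exact Nat.pow_le_pow_right (by omega) (by omega)
  have hHc : finrank F H ≤ c := by
    -- The term `4 * finrank F E` in `hq` pays for the members not containing `H`; two others
    -- remain, and their intersection bounds `H`.
    have h2 : 1 < #{A ∈ C | H ≤ A} := by
      have h3 := Finset.card_filter_add_card_filter_not (s := C) (fun A => H ≤ A)
      nlinarith
    obtain ⟨A, hA, B, hB, hAB⟩ := Finset.one_lt_card.1 h2
    rw [Finset.mem_filter] at hA hB
    rw [← hc A hA.1 B hB.1 hAB]
    exact Submodule.finrank_mono (le_inf hA.2 hB.2)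
  have hcH : ∀ A ∈ C, c ≤ finrank F (H ⊓ A : Submodule F E) := by
    intro A hA
    by_contra! hlt
    obtain ⟨i, rfl⟩ : ∃ i, c = i + 1 := ⟨c - 1, by omega⟩
    have hsum := sum_degree_eq C hk hc hA
    -- If `H ⊓ A` were too small, `A` would have too few incidences: vectors in `H` count at most
    -- `#C` each, the others at most `T`.
    have hle : ∑ x : E with x ∈ A, #{B ∈ C | x ∈ B} ≤ q ^ i * #C + q ^ (j + 1) * T := by
      calc _ ≤ ∑ x : E with x ∈ A, ((if x ∈ H then #C else 0) + T) := by
            refine Finset.sum_le_sum fun x _ => ?_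
            split_ifs with h
            · exact (Finset.card_filter_le _ _).trans (Nat.le_add_right _ _)
            · rw [zero_add]
              exact hlow x h
        _ = q ^ finrank F (H ⊓ A : Submodule F E) * #C + q ^ (j + 1) * T := by
            rw [Finset.sum_add_distrib, Finset.sum_const, ← Finset.sum_filter, Finset.sum_const,
              smul_eq_mul, smul_eq_mul, ← hk A hA, hqdef, ← natCard_eq_pow_finrank (K := F),
              ← natCard_eq_pow_finrank (K := F), Nat.card_eq_fintype_card, Fintype.card_subtype,
              Nat.card_eq_fintype_card, Fintype.card_subtype, Finset.filter_filter]
            simp only [Submodule.mem_inf, and_comm]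
        _ ≤ _ := by
            gcongr
            · omega
            · omega
    rw [hsum] at hle
    have hM1 : #C - 1 + 1 = #C := by omega
    generalize #C - 1 = M' at *
    rw [← hM1] at hle hM
    have hij : q ^ (i + 1) ≤ q ^ (j + 1) := Nat.pow_le_pow_right (by omega) (by omega)
    have hqi : 1 ≤ q ^ i := Nat.one_le_pow _ _ (by omega)
    have e1 : q ^ (j + 1) * T = 4 * q ^ (2 * j + 1) := by rw [hT]; ring
    rw [e1] at hle
    -- The size threshold absorbs the error `q ^ k * T` into `4 * M'`; then `q ≥ 9` makes the main
    -- term `M' * q ^ (i + 1)` too large.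
    have h5 : 4 * q ^ (2 * j + 1) ≤ 4 * M' := by omega
    have h6 : 9 * q ^ i ≤ q ^ (i + 1) := by
      rw [pow_succ']
      exact Nat.mul_le_mul_right _ (by omega)
    nlinarith
  obtain ⟨A, hA⟩ : C.Nonempty := Finset.card_pos.1 (by omega)
  have hle : ∀ A ∈ C, H ≤ A := fun A hA => by
    have : H ⊓ A = H := Submodule.eq_of_le_of_finrank_le inf_le_left (hHc.trans (hcH A hA))
    exact inf_eq_left.1 this
  refine ⟨H, le_antisymm hHc ?_, hle⟩
  have := hcH A hA
  rwa [inf_eq_left.2 (hle A hA)] at this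

open Classical in
/-- The packing bound for a sunflower with a `c`-dimensional kernel. -/
theorem card_sunflower_mul_le (C : Finset (Submodule F E)) {k c : ℕ} (hck : c < k)
    (hk : ∀ A ∈ C, finrank F A = k)
    (hc : ∀ A ∈ C, ∀ B ∈ C, A ≠ B → finrank F (A ⊓ B : Submodule F E) = c)
    {H : Submodule F E} (hH : finrank F H = c) (hHA : ∀ A ∈ C, H ≤ A) :
    #C * (Nat.card F ^ (k - c) - 1) ≤ Nat.card F ^ (finrank F E - c) - 1 := by
  have := Fintype.ofFinite E
  let S : Submodule F E → Finset E := fun A => {x | x ∈ A}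
  have hmem : ∀ A x, x ∈ S A ↔ x ∈ A := by simp [S]
  have hcard : ∀ A : Submodule F E, #(S A) = Nat.card F ^ finrank F A := by
    intro A
    rw [← natCard_eq_pow_finrank (K := F), Nat.card_eq_fintype_card, Fintype.card_subtype]
  have hsubset : ∀ A ∈ C, S H ⊆ S A := by
    intro A hA x
    rw [hmem, hmem]
    exact fun h => hHA A hA h
  have hpetal : ∀ A ∈ C, #(S A \ S H) =
      Nat.card F ^ k - Nat.card F ^ c := by
    intro A hA
    rw [Finset.card_sdiff_of_subset (hsubset A hA), hcard, hcard, hk A hA, hH]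
  have hdisj : (C : Set (Submodule F E)).PairwiseDisjoint
      fun A => S A \ S H := by
    intro A hA B hB hAB
    rw [Function.onFun, Finset.disjoint_left]
    intro x hxA hxB
    rw [Finset.mem_sdiff, hmem, hmem] at hxA hxB
    have hHAB : H = A ⊓ B := Submodule.eq_of_le_of_finrank_le (le_inf (hHA A hA) (hHA B hB))
      (by rw [hc A hA B hB hAB, hH])
    exact hxA.2 (hHAB ▸ ⟨hxA.1, hxB.1⟩)
  have hunion : #(C.biUnion fun A => S A \ S H) ≤
      #(S H)ᶜ := by
    refine Finset.card_le_card fun x hx => ?_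
    obtain ⟨A, -, hx⟩ := Finset.mem_biUnion.1 hx
    exact Finset.mem_compl.2 (Finset.mem_sdiff.1 hx).2
  rw [Finset.card_biUnion hdisj, Finset.sum_congr rfl hpetal, Finset.sum_const, smul_eq_mul,
    Finset.card_compl, hcard, hH, ← Nat.card_eq_fintype_card,
    natCard_eq_pow_finrank (K := F) (V := E)] at hunion
  have hcE : c ≤ finrank F E := hH ▸ Submodule.finrank_le H
  have hpos : 0 < Nat.card F ^ c := pow_pos Nat.card_pos _
  refine Nat.le_of_mul_le_mul_left ?_ hpos
  calc _ = #C * (Nat.card F ^ (c + (k - c)) - Nat.card F ^ c) := by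
        rw [pow_add, ← Nat.mul_sub_one, Nat.mul_left_comm]
    _ ≤ Nat.card F ^ (c + (finrank F E - c)) - Nat.card F ^ c := by
        rwa [Nat.add_sub_cancel' hck.le, Nat.add_sub_cancel' hcE]
    _ = _ := by rw [pow_add, ← Nat.mul_sub_one]

end Sunflower

/-! ### Companion matrices of irreducible polynomials generate fields. -/

section Companion

open Matrix

variable {F : Type*} [Field F]

/-- The first basis row vector is cyclic for the companion matrix. -/
theorem single_vecMul_companionMatrix_pow {s : ℕ} (p : F[X]) (hs : 0 < s) (i : ℕ) (hi : i < s) :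
    Pi.single (⟨0, hs⟩ : Fin s) (1 : F) ᵥ* companionMatrix s p ^ i = Pi.single ⟨i, hi⟩ 1 := by
  induction i with
  | zero => simp
  | succ i ih =>
    rw [pow_succ, ← vecMul_vecMul, ih (by omega), single_one_vecMul]
    ext b
    simp only [companionMatrix, Matrix.row, Matrix.of_apply, Pi.single_apply, Fin.ext_iff]
    rw [if_neg (by omega)]
    simp only [eq_comm]

/-- A monic polynomial annihilates its companion matrix. -/
theorem aeval_companionMatrix {s : ℕ} {p : F[X]} (hp : p.Monic) (hd : p.natDegree = s)
    (hs : 0 < s) : aeval (companionMatrix s p) p = 0 := by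
  set P := companionMatrix s p with hP
  have h0 : Pi.single (⟨0, hs⟩ : Fin s) (1 : F) ᵥ* aeval P p = 0 := by
    have hlast : Pi.single (⟨0, hs⟩ : Fin s) (1 : F) ᵥ* P ^ s =
        fun b : Fin s => -p.coeff b := by
      obtain ⟨t, rfl⟩ : ∃ t, s = t + 1 := ⟨s - 1, by omega⟩
      rw [pow_succ, ← vecMul_vecMul, hP, single_vecMul_companionMatrix_pow p hs t (by omega),
        single_one_vecMul]
      ext b
      simp [companionMatrix, Matrix.row]
    rw [aeval_eq_sum_range, hd, Finset.sum_range_succ, show p.coeff s = 1 from hd ▸ hp.coeff_natDegree,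
      one_smul, vecMul_add, hlast, ← Fin.sum_univ_eq_sum_range (fun i => p.coeff i • P ^ i)]
    ext b
    rw [Pi.add_apply, Matrix.vecMul_sum]
    simp only [vecMul_smul, hP, single_vecMul_companionMatrix_pow p hs _ (Fin.is_lt _)]
    simp [Finset.sum_apply, Pi.single_apply]
  -- The other basis vectors are images of the first under powers of `P`, which commute with `aeval
  -- P p`.
  ext i j
  have hcomm : P ^ (i : ℕ) * aeval P p = aeval P p * P ^ (i : ℕ) := by
    rw [← aeval_X_pow (R := F) P, ← map_mul, ← map_mul, mul_comm]
  have hi : Pi.single i (1 : F) ᵥ* aeval P p = 0 := by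
    rw [← single_vecMul_companionMatrix_pow p hs i i.2, vecMul_vecMul, ← hP,
      hcomm, ← vecMul_vecMul, h0, zero_vecMul]
  rw [single_one_vecMul] at hi
  exact congrFun hi j

/-- The algebra is the image of the field `AdjoinRoot p`, and a homomorphism from a field to a
nonzero ring is injective. -/
theorem companionMatrix_adjoin {s : ℕ} {p : F[X]} (hp : p.Monic) (hirr : Irreducible p)
    (hd : p.natDegree = s) (hs : 0 < s) :
    Nat.card (Algebra.adjoin F {companionMatrix s p}) = Nat.card F ^ s ∧
      ∀ A ∈ Algebra.adjoin F {companionMatrix s p}, A ≠ 0 → IsUnit A := by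
  have := Fact.mk hirr
  have : Nonempty (Fin s) := ⟨⟨0, hs⟩⟩
  let φ : AdjoinRoot p →ₐ[F] Matrix (Fin s) (Fin s) F :=
    Ideal.Quotient.liftₐ (Ideal.span {p}) (aeval (companionMatrix s p)) fun a ha => by
      obtain ⟨b, rfl⟩ := Ideal.mem_span_singleton.1 ha
      rw [map_mul, aeval_companionMatrix hp hd hs, zero_mul]
  have hφ : Algebra.adjoin F {companionMatrix s p} = φ.range := by
    rw [Algebra.adjoin_singleton_eq_range_aeval]
    ext A
    constructor
    · rintro ⟨f, rfl⟩
      exact ⟨AdjoinRoot.mk p f, rfl⟩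
    · rintro ⟨a, rfl⟩
      obtain ⟨f, rfl⟩ := AdjoinRoot.mk_surjective a
      exact ⟨f, rfl⟩
  have hinj : Function.Injective φ := φ.toRingHom.injective
  rw [hφ]
  constructor
  · have h1 := Nat.card_congr (AlgEquiv.ofInjective φ hinj).toEquiv
    rw [← h1, Nat.card_congr (AdjoinRoot.powerBasis' hp).basis.equivFun.toEquiv, Nat.card_fun,
      Nat.card_eq_fintype_card (α := Fin _), Fintype.card_fin, AdjoinRoot.powerBasis'_dim, hd]
  · rintro _ ⟨a, rfl⟩ ha
    refine IsUnit.map φ.toRingHom (isUnit_iff_ne_zero.2 ?_)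
    rintro rfl
    exact ha (map_zero _)

end Companion

/-! ### The sunflower code: intersections and cardinality. -/

section SunflowerCode

open Matrix Module

theorem finrank_inf_of_isIntersectingCode {F : Type*} [Field F] {n k c : ℕ} (hck : c < k)
    {C : Set (Submodule F (Fin n → F))} (hC : IsIntersectingCode k c C)
    {U V : Submodule F (Fin n → F)} (hU : U ∈ C) (hV : V ∈ C) (hUV : U ≠ V) :
    finrank F (U ⊓ V : Submodule F (Fin n → F)) = c := by
  have h := hC.2.1 U hU V hV hUV
  have hU' : finrank F U = k := hC.1.1 hU
  have hV' : finrank F V = k := hC.1.1 hV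
  have hle : finrank F (U ⊓ V : Submodule F (Fin n → F)) ≤ finrank F U :=
    Submodule.finrank_mono inf_le_left
  rw [hC.2.2, subspaceDist, hU', hV'] at h
  omega

theorem isIntersectingCode_of_finrank_inf {F : Type*} [Field F] {n k c : ℕ}
    {C : Set (Submodule F (Fin n → F))} (hnt : C.Nontrivial) (hk : ∀ U ∈ C, finrank F U = k)
    (hc : ∀ U ∈ C, ∀ V ∈ C, U ≠ V → finrank F (U ⊓ V : Submodule F (Fin n → F)) = c) :
    IsIntersectingCode k c C := by
  have hd : ∀ U ∈ C, ∀ V ∈ C, U ≠ V → subspaceDist U V = 2 * (k - c) := by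
    intro U hU V hV hUV
    rw [subspaceDist, hk U hU, hk V hV, hc U hU V hV hUV]
    omega
  have hmin : minSubspaceDist C = 2 * (k - c) := by
    obtain ⟨U, hU, V, hV, hUV⟩ := hnt
    have : {d | ∃ U ∈ C, ∃ V ∈ C, U ≠ V ∧ subspaceDist U V = d} = {2 * (k - c)} := by
      ext d
      constructor
      · rintro ⟨U, hU, V, hV, hUV, rfl⟩
        exact hd U hU V hV hUV
      · rintro rfl
        exact ⟨U, hU, V, hV, hUV, hd U hU V hV hUV⟩
    rw [minSubspaceDist, this, csInf_singleton]
  exact ⟨⟨hk, hnt⟩, fun U hU V hV hUV => (hd U hU V hV hUV).trans hmin.symm, hmin⟩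

variable {F : Type*} [Field F]

/-- The map induces an isomorphism from the quotient by the preimage onto the quotient by `U`. -/
theorem finrank_comap_of_surjective {V W : Type*} [AddCommGroup V] [Module F V]
    [FiniteDimensional F V] [AddCommGroup W] [Module F W] [FiniteDimensional F W]
    {f : V →ₗ[F] W} (hf : Function.Surjective f) (U : Submodule F W) :
    finrank F (U.comap f) + finrank F W = finrank F U + finrank F V := by
  have h1 := (U.mkQ.comp f).finrank_range_add_finrank_ker
  rw [LinearMap.range_eq_top.2 (by simpa using U.mkQ_surjective.comp hf), finrank_top,
    LinearMap.ker_comp, Submodule.ker_mkQ] at h1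
  have h2 := U.finrank_quotient_add_finrank
  omega

variable {c s m r : ℕ}

/-- The matrix `[N_0 ⋯ N_{m-1} L]`. -/
def blockRow (N : Fin m → Matrix (Fin s) (Fin s) F) (L : Matrix (Fin s) (Fin (r + s)) F) :
    Matrix (Fin s) ((Fin m × Fin s) ⊕ Fin (r + s)) F :=
  Matrix.fromCols (Matrix.of fun a jb => N jb.1 a jb.2) L

theorem vecMul_blockRow_inl (N : Fin m → Matrix (Fin s) (Fin s) F)
    (L : Matrix (Fin s) (Fin (r + s)) F) (v : Fin s → F) (j : Fin m) :
    (fun b => (v ᵥ* blockRow N L) (Sum.inl (j, b))) = v ᵥ* N j := rfl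

theorem vecMul_blockRow_inr (N : Fin m → Matrix (Fin s) (Fin s) F)
    (L : Matrix (Fin s) (Fin (r + s)) F) (v : Fin s → F) :
    (fun b => (v ᵥ* blockRow N L) (Sum.inr b)) = v ᵥ* L := rfl

theorem vecMul_blockRow_eq {N N' : Fin m → Matrix (Fin s) (Fin s) F}
    {L L' : Matrix (Fin s) (Fin (r + s)) F} {v w : Fin s → F}
    (h : v ᵥ* blockRow N L = w ᵥ* blockRow N' L') :
    (∀ j, v ᵥ* N j = w ᵥ* N' j) ∧ v ᵥ* L = w ᵥ* L' := by
  refine ⟨fun j => ?_, ?_⟩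
  · rw [← vecMul_blockRow_inl N L, ← vecMul_blockRow_inl N' L', h]
  · rw [← vecMul_blockRow_inr N L, ← vecMul_blockRow_inr N' L', h]

/-- Forgetting the first `c` coordinates. -/
def dropColumns (c s m r : ℕ) {n : ℕ} (hn : c + (m * s + (r + s)) = n) :
    (Fin n → F) →ₗ[F] ((Fin m × Fin s) ⊕ Fin (r + s) → F) :=
  LinearMap.funLeft F F fun j => finCongr hn (columnBlocks c s m r (Sum.inr j))

theorem dropColumns_surjective {n : ℕ} (hn : c + (m * s + (r + s)) = n) :
    Function.Surjective (dropColumns (F := F) c s m r hn) :=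
  LinearMap.funLeft_surjective_of_injective _ _ _ fun i j h => by simpa using h

/-- The block `I_c` leaves the first `c` coordinates free. Viewing codewords as preimages reduces
the dimension counts to the block rows. -/
theorem map_rowsp_sunflowerMatrix {n : ℕ} (hn : c + (m * s + (r + s)) = n)
    (N : Fin m → Matrix (Fin s) (Fin s) F) (L : Matrix (Fin s) (Fin (r + s)) F) :
    (rowsp (sunflowerMatrix (c := c) N L)).map
        (LinearEquiv.funCongrLeft F F (finCongr hn.symm)).toLinearMap =
      (LinearMap.range (blockRow N L).vecMulLinear).comap (dropColumns c s m r hn) := by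
  subst hn
  have hid : (LinearEquiv.funCongrLeft F F (finCongr rfl)).toLinearMap =
      (LinearMap.id : (Fin (c + (m * s + (r + s))) → F) →ₗ[F] _) := rfl
  rw [hid, Submodule.map_id, rowsp, ← range_vecMulLinear]
  have hcoord : ∀ (w : Fin c ⊕ Fin s → F) j,
      (w ᵥ* sunflowerMatrix (c := c) N L) (columnBlocks c s m r j) =
        Sum.elim (w ∘ Sum.inl) ((w ∘ Sum.inr) ᵥ* blockRow N L) j := by
    intro w j
    have : (w ᵥ* sunflowerMatrix (c := c) N L) (columnBlocks c s m r j) =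
        (w ᵥ* Matrix.fromBlocks 1 0 0 (blockRow N L)) j := by
      simp [sunflowerMatrix, blockRow, Matrix.vecMul, dotProduct]
    rw [this, Matrix.vecMul_fromBlocks]
    simp
  ext u
  simp only [LinearMap.mem_range, Submodule.mem_comap, Matrix.vecMulLinear_apply]
  constructor
  · rintro ⟨w, rfl⟩
    exact ⟨w ∘ Sum.inr, funext fun j => (hcoord w (Sum.inr j)).symm⟩
  · rintro ⟨v, hv⟩
    refine ⟨Sum.elim (fun i => u (columnBlocks c s m r (Sum.inl i))) v, funext fun i => ?_⟩
    obtain ⟨j, rfl⟩ := (columnBlocks c s m r).surjective i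
    rw [hcoord]
    rcases j with j | j
    · rfl
    · exact congrFun hv j

/-- Padding `v` with `r` leading zeros turns the product with the last rows into a product with the
invertible matrix `A`. -/
theorem vecMul_lastRows_eq_zero {A : Matrix (Fin (r + s)) (Fin (r + s)) F} (hA : IsUnit A)
    {v : Fin s → F} (h : v ᵥ* lastRows A = 0) : v = 0 := by
  have h1 : Fin.append (0 : Fin r → F) v ᵥ* A = 0 := by
    rw [← h]
    ext b
    simp [Matrix.vecMul, dotProduct, Fin.sum_univ_add, lastRows]
  have h2 : Fin.append (0 : Fin r → F) v = 0 :=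
    Matrix.vecMul_injective_of_isUnit hA (h1.trans (zero_vecMul A).symm)
  ext i
  simpa using congrFun h2 (Fin.natAdd r i)

/-- The parameters of the codewords of the sunflower code: the position of the identity block, the
blocks to its right and the last block, or `none` for the exceptional codeword. -/
abbrev SunflowerParam (K : Subalgebra F (Matrix (Fin s) (Fin s) F))
    (K' : Subalgebra F (Matrix (Fin (r + s)) (Fin (r + s)) F)) (m : ℕ) : Type _ :=
  Option (Σ i : Fin m, ({j : Fin m // i < j} → K) × K')

variable {K : Subalgebra F (Matrix (Fin s) (Fin s) F)}
  {K' : Subalgebra F (Matrix (Fin (r + s)) (Fin (r + s)) F)}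

/-- The sequence of square blocks with the identity at position `i`. -/
def squareBlocks (i : Fin m) (A : {j : Fin m // i < j} → K) : Fin m → Matrix (Fin s) (Fin s) F :=
  fun j => if h : i < j then (A ⟨j, h⟩ : Matrix (Fin s) (Fin s) F) else if j = i then 1 else 0

theorem squareBlocks_self (i : Fin m) (A : {j : Fin m // i < j} → K) : squareBlocks i A i = 1 := by
  simp [squareBlocks]

theorem squareBlocks_of_lt (i : Fin m) (A : {j : Fin m // i < j} → K) {j : Fin m} (h : j < i) :
    squareBlocks i A j = 0 := by
  simp [squareBlocks, h.not_gt, h.ne]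

theorem squareBlocks_of_gt (i : Fin m) (A : {j : Fin m // i < j} → K) {j : Fin m} (h : i < j) :
    squareBlocks i A j = A ⟨j, h⟩ := by
  simp [squareBlocks, h]

/-- The block row of a codeword of the sunflower code. -/
def paramBlockRow : SunflowerParam K K' m → Matrix (Fin s) ((Fin m × Fin s) ⊕ Fin (r + s)) F
  | none => blockRow (fun _ => 0) (lastRows 1)
  | some x => blockRow (squareBlocks x.1 x.2.1) (lastRows x.2.2.1)

theorem paramBlockRow_none :
    paramBlockRow (none : SunflowerParam K K' m) = blockRow (fun _ => 0) (lastRows 1) := rfl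

theorem paramBlockRow_some (i : Fin m) (A : {j : Fin m // i < j} → K) (A' : K') :
    paramBlockRow (some ⟨i, A, A'⟩ : SunflowerParam K K' m) =
      blockRow (squareBlocks i A) (lastRows A'.1) := rfl

theorem vecMul_paramBlockRow_eq_zero (x : SunflowerParam K K' m) {v : Fin s → F}
    (h : v ᵥ* paramBlockRow x = 0) : v = 0 := by
  rw [← zero_vecMul (paramBlockRow x)] at h
  rcases x with _ | ⟨i, A, A'⟩
  · rw [paramBlockRow_none] at h
    exact vecMul_lastRows_eq_zero isUnit_one
      ((vecMul_blockRow_eq h).2.trans (zero_vecMul _))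
  · rw [paramBlockRow_some] at h
    simpa [squareBlocks_self] using (vecMul_blockRow_eq h).1 i

/-- The row spaces of different block rows meet trivially. -/
theorem vecMul_paramBlockRow_eq (hK : ∀ A ∈ K, A ≠ 0 → IsUnit A)
    (hK' : ∀ A ∈ K', A ≠ 0 → IsUnit A) (x y : SunflowerParam K K' m) (hxy : x ≠ y)
    {v w : Fin s → F} (h : v ᵥ* paramBlockRow x = w ᵥ* paramBlockRow y) : v = 0 := by
  rcases x with _ | ⟨i, A, A'⟩
  · rcases y with _ | ⟨i, A, A'⟩
    · exact absurd rfl hxy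
    · rw [paramBlockRow_none, paramBlockRow_some] at h
      obtain ⟨h1, h2⟩ := vecMul_blockRow_eq h
      have hw : w = 0 := by simpa [squareBlocks_self] using (h1 i).symm
      rw [hw, zero_vecMul] at h2
      exact vecMul_lastRows_eq_zero isUnit_one h2
  · rcases y with _ | ⟨i', B, B'⟩
    · rw [paramBlockRow_none, paramBlockRow_some] at h
      simpa [squareBlocks_self] using (vecMul_blockRow_eq h).1 i
    · rw [paramBlockRow_some, paramBlockRow_some] at h
      obtain ⟨h1, h2⟩ := vecMul_blockRow_eq h
      -- With different pivots, the column block of the earlier pivot is zero in the other word.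
      -- With equal pivots `v = w`, and an invertible difference of blocks kills `v`.
      rcases lt_trichotomy i i' with hi | rfl | hi
      · simpa [squareBlocks_self, squareBlocks_of_lt _ _ hi] using h1 i
      · have hvw : v = w := by simpa [squareBlocks_self] using h1 i
        subst hvw
        by_cases hA : A = B
        · have hA' : A' ≠ B' := by
            rintro rfl
            exact hxy (by rw [hA])
          refine vecMul_lastRows_eq_zero (hK' _ (A' - B').2 ?_) (v := v) ?_
          · simpa [sub_eq_zero] using hA'
          · have : lastRows ((A' - B' : K') : Matrix _ _ F) =
                lastRows A'.1 - lastRows B'.1 := rfl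
            rw [this, vecMul_sub, sub_eq_zero]
            exact h2
        · obtain ⟨j, hj⟩ := Function.ne_iff.1 hA
          have hj1 := h1 j
          rw [squareBlocks_of_gt _ _ j.2, squareBlocks_of_gt _ _ j.2, ← sub_eq_zero,
            ← vecMul_sub] at hj1
          have hu := hK _ (A j - B j).2 (by simpa [sub_eq_zero] using hj)
          exact Matrix.vecMul_injective_of_isUnit hu (hj1.trans (zero_vecMul _).symm)
      · have hw : w = 0 := by
          simpa [squareBlocks_self, squareBlocks_of_lt _ _ hi] using (h1 i').symm
        simpa [squareBlocks_self, hw] using h1 i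

theorem finrank_range_paramBlockRow (x : SunflowerParam K K' m) :
    finrank F (LinearMap.range (paramBlockRow x).vecMulLinear) = s := by
  rw [LinearMap.finrank_range_of_inj, finrank_fin_fun]
  rw [← LinearMap.ker_eq_bot, LinearMap.ker_eq_bot']
  exact fun v hv => vecMul_paramBlockRow_eq_zero x hv

theorem range_paramBlockRow_inf (hK : ∀ A ∈ K, A ≠ 0 → IsUnit A)
    (hK' : ∀ A ∈ K', A ≠ 0 → IsUnit A) (x y : SunflowerParam K K' m) (hxy : x ≠ y) :
    LinearMap.range (paramBlockRow x).vecMulLinear ⊓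
      LinearMap.range (paramBlockRow y).vecMulLinear = ⊥ := by
  rw [eq_bot_iff]
  rintro _ ⟨⟨v, rfl⟩, ⟨w, hw⟩⟩
  have hv : v = 0 := vecMul_paramBlockRow_eq hK hK' x y hxy hw.symm
  simp [hv]

/-- The codeword with a given parameter. -/
def sunflowerWord (c : ℕ) {n : ℕ} (hn : c + (m * s + (r + s)) = n) (x : SunflowerParam K K' m) :
    Submodule F (Fin n → F) :=
  (LinearMap.range (paramBlockRow x).vecMulLinear).comap (dropColumns c s m r hn)

theorem finrank_sunflowerWord {n : ℕ} (hn : c + (m * s + (r + s)) = n)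
    (x : SunflowerParam K K' m) : finrank F (sunflowerWord c hn x) = c + s := by
  have h := finrank_comap_of_surjective (dropColumns_surjective (F := F) hn)
    (LinearMap.range (paramBlockRow x).vecMulLinear)
  rw [finrank_range_paramBlockRow, finrank_fin_fun, finrank_fintype_fun_eq_card] at h
  simp only [Fintype.card_sum, Fintype.card_prod, Fintype.card_fin] at h
  rw [sunflowerWord]
  omega

theorem finrank_sunflowerWord_inf {n : ℕ} (hn : c + (m * s + (r + s)) = n)
    (hK : ∀ A ∈ K, A ≠ 0 → IsUnit A) (hK' : ∀ A ∈ K', A ≠ 0 → IsUnit A)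
    (x y : SunflowerParam K K' m) (hxy : x ≠ y) :
    finrank F (sunflowerWord c hn x ⊓ sunflowerWord c hn y : Submodule F (Fin n → F)) = c := by
  have h := finrank_comap_of_surjective (dropColumns_surjective (F := F) hn)
    (LinearMap.range (paramBlockRow x).vecMulLinear ⊓
      LinearMap.range (paramBlockRow y).vecMulLinear)
  rw [Submodule.comap_inf, range_paramBlockRow_inf hK hK' x y hxy, finrank_bot, finrank_fin_fun,
    finrank_fintype_fun_eq_card] at h
  simp only [Fintype.card_sum, Fintype.card_prod, Fintype.card_fin] at h
  rw [sunflowerWord, sunflowerWord]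
  omega

theorem sunflowerWord_injective {n : ℕ} (hn : c + (m * s + (r + s)) = n) (hs : 0 < s)
    (hK : ∀ A ∈ K, A ≠ 0 → IsUnit A) (hK' : ∀ A ∈ K', A ≠ 0 → IsUnit A) :
    Function.Injective (sunflowerWord (K := K) (K' := K') c hn) := by
  intro x y h
  by_contra hxy
  have h1 := finrank_sunflowerWord_inf hn hK hK' x y hxy
  rw [h, inf_idem, finrank_sunflowerWord] at h1
  omega

/-- A pivot at `i` leaves `m - 1 - i` free square blocks, so the count is a geometric sum times `b`,
plus one; the factor `a - 1` avoids division. -/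
theorem card_sunflowerParam [Finite F] {a b : ℕ} (hK : Nat.card K = a) (hK' : Nat.card K' = b) :
    (Nat.card (SunflowerParam K K' m) : ℤ) * (a - 1) = a - 1 + b * (a ^ m - 1) := by
  have h : Nat.card (SunflowerParam K K' m) = (∑ i ∈ Finset.range m, a ^ i) * b + 1 := by
    rw [Finite.card_option, Nat.card_sigma, ← Finset.sum_range_reflect,
      ← Fin.sum_univ_eq_sum_range (fun i => a ^ (m - 1 - i)), Finset.sum_mul]
    congr 1
    refine Finset.sum_congr rfl fun i _ => ?_
    rw [Nat.card_prod, hK', Nat.card_fun, hK, Nat.card_eq_fintype_card, Fintype.card_subtype]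
    have : (Finset.univ.filter fun j : Fin m => i < j) = Finset.Ioi i := by ext; simp
    rw [this, Fin.card_Ioi]
  rw [h]
  push_cast
  have := geom_sum_mul (a : ℤ) m
  linear_combination (b : ℤ) * this

theorem image_sunflowerCodeBlocks {n : ℕ} (hn : c + (m * s + (r + s)) = n) (p p' : F[X]) :
    Submodule.map (LinearEquiv.funCongrLeft F F (finCongr hn.symm)).toLinearMap ''
        sunflowerCodeBlocks c s m r p p' =
      Set.range (sunflowerWord (K := Algebra.adjoin F {companionMatrix s p})
        (K' := Algebra.adjoin F {companionMatrix (r + s) p'}) (m := m) c hn) := by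
  ext U
  constructor
  · rintro ⟨_, ⟨i, A, A', hA, hA', rfl⟩ | rfl, rfl⟩
    · refine ⟨some ⟨i, fun j => ⟨A j, hA j⟩, ⟨A', hA'⟩⟩, ?_⟩
      rw [map_rowsp_sunflowerMatrix, sunflowerWord, paramBlockRow_some]
      have : squareBlocks i (fun j => (⟨A j, hA j⟩ : Algebra.adjoin F {companionMatrix s p})) =
          fun j => if j < i then 0 else if j = i then 1 else A j := by
        funext j
        rcases lt_trichotomy i j with h | rfl | h
        · simp [squareBlocks_of_gt _ _ h, h.not_gt, h.ne']
        · simp [squareBlocks_self]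
        · simp [squareBlocks_of_lt _ _ h, h]
      rw [this]
    · refine ⟨none, ?_⟩
      rw [map_rowsp_sunflowerMatrix, sunflowerWord, paramBlockRow_none]
  · rintro ⟨_ | ⟨i, A, A'⟩, rfl⟩
    · refine ⟨_, Or.inr rfl, ?_⟩
      rw [map_rowsp_sunflowerMatrix, sunflowerWord, paramBlockRow_none]
    · refine ⟨_, Or.inl ⟨i, squareBlocks i A, A', fun j => ?_, A'.2, rfl⟩, ?_⟩
      · rcases lt_trichotomy i j with h | rfl | h
        · rw [squareBlocks_of_gt _ _ h]
          exact (A _).2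
        · rw [squareBlocks_self]
          exact one_mem _
        · rw [squareBlocks_of_lt _ _ h]
          exact zero_mem _
      · rw [map_rowsp_sunflowerMatrix, sunflowerWord, paramBlockRow_some]
        have : (fun j => if j < i then 0 else if j = i then 1 else squareBlocks i A j) =
            squareBlocks i A := by
          funext j
          rcases lt_trichotomy i j with h | rfl | h
          · simp [h.not_gt, h.ne']
          · simp [squareBlocks_self]
          · simp [squareBlocks_of_lt _ _ h, h]
        rw [this]

/-- The sunflower code is an equidistant `c`-intersecting code of known size. -/
theorem sunflowerCode_spec [Finite F] {k n c : ℕ} (hc : c < k) (hn : 2 * k ≤ n + c) {p p' : F[X]}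
    (hp : p.Monic) (hirr : Irreducible p) (hd : p.natDegree = k - c)
    (hp' : p'.Monic) (hirr' : Irreducible p') (hd' : p'.natDegree = k - c + (n - c) % (k - c)) :
    IsIntersectingCode k c (sunflowerCode hc hn p p') ∧
      ((sunflowerCode hc hn p p').ncard : ℤ) * ((Nat.card F : ℤ) ^ (k - c) - 1) =
        (Nat.card F : ℤ) ^ (k - c) - 1 + ((Nat.card F : ℤ) ^ (n - c) -
          (Nat.card F : ℤ) ^ ((n - c) % (k - c) + (k - c))) := by
  have hcols := sunflower_columns hc hn
  -- A square block must exist, so that the exceptional codeword is not the only one.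
  have hpos : 0 < (n - c) / (k - c) - 1 := by
    have : 2 ≤ (n - c) / (k - c) := by
      rw [Nat.le_div_iff_mul_le (by omega)]
      omega
    omega
  have heq : sunflowerCode hc hn p p' = Set.range (sunflowerWord c hcols) :=
    image_sunflowerCodeBlocks hcols p p'
  rw [heq]
  generalize (n - c) / (k - c) - 1 = m at *
  have hnc : n - c = (n - c) % (k - c) + (k - c) + (k - c) * m := by
    have := mul_comm m (k - c)
    omega
  generalize (n - c) % (k - c) = r at *
  have hs : 0 < k - c := by omega
  obtain ⟨hK1, hK2⟩ := companionMatrix_adjoin hp hirr hd hs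
  obtain ⟨hL1, hL2⟩ := companionMatrix_adjoin hp' hirr' (hd'.trans (add_comm _ _)) (by omega)
  have hinj := sunflowerWord_injective (m := m) hcols hs hK2 hL2
  constructor
  · refine isIntersectingCode_of_finrank_inf ?_ ?_ ?_
    · exact ⟨_, ⟨none, rfl⟩, _, ⟨some ⟨⟨0, hpos⟩, 0, 0⟩, rfl⟩, hinj.ne (by simp)⟩
    · rintro _ ⟨x, rfl⟩
      rw [finrank_sunflowerWord]
      omega
    · rintro _ ⟨x, rfl⟩ _ ⟨y, rfl⟩ hxy
      exact finrank_sunflowerWord_inf hcols hK2 hL2 x y fun h => hxy (h ▸ rfl)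
  · have h := card_sunflowerParam (m := m) hK1 hL1
    rw [← Nat.card_coe_set_eq, Nat.card_range_of_injective hinj, hnc]
    push_cast at h
    rw [h]
    ring

end SunflowerCode

/-! ### Comparison of the sunflower code with the maximum. -/

section MaxCard

open Module

variable {F : Type*} [Field F] [Finite F] {k n c : ℕ}

/-- A code is either small or bounded by the packing bound for sunflowers. -/
theorem ncard_intersectingCode_le (hc : c < k) (hq : 4 * n + 9 ≤ Nat.card F)
    {C : Set (Submodule F (Fin n → F))} (hC : IsIntersectingCode k c C) :
    C.ncard ≤ Nat.card F ^ (2 * k - 1) ∨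
      C.ncard * (Nat.card F ^ (k - c) - 1) ≤ Nat.card F ^ (n - c) - 1 := by
  refine or_iff_not_imp_left.2 fun hbig => ?_
  have hfin : C.Finite := Set.toFinite C
  rw [Set.ncard_eq_toFinset_card C hfin] at hbig ⊢
  have hk : ∀ A ∈ hfin.toFinset, finrank F A = k := fun A hA => hC.1.1 (hfin.mem_toFinset.1 hA)
  have hint : ∀ A ∈ hfin.toFinset, ∀ B ∈ hfin.toFinset, A ≠ B →
      finrank F (A ⊓ B : Submodule F (Fin n → F)) = c := fun A hA B hB hAB =>
    finrank_inf_of_isIntersectingCode hc hC (hfin.mem_toFinset.1 hA) (hfin.mem_toFinset.1 hB) hAB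
  obtain ⟨H, hH, hHA⟩ := exists_sunflower_kernel _ hc hk hint
    (by rwa [finrank_fin_fun]) (not_le.1 hbig)
  simpa only [finrank_fin_fun] using card_sunflower_mul_le _ hc hk hint hH hHA

variable {p p' : F[X]}

/-- As `h ≥ 2`, the subtracted power in the exact count is at most `q ^ (n - k)`, while `q ^ (n - c)
= q ^ (n - k) * Q`. -/
theorem pow_le_ncard_sunflowerCode (hc : c < k) (hn : 2 * k ≤ n + c)
    (hp : p.Monic) (hirr : Irreducible p) (hd : p.natDegree = k - c)
    (hp' : p'.Monic) (hirr' : Irreducible p') (hd' : p'.natDegree = k - c + (n - c) % (k - c)) :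
    Nat.card F ^ (n - k) ≤ (sunflowerCode hc hn p p').ncard := by
  have hcard := (sunflowerCode_spec hc hn hp hirr hd hp' hirr' hd').2
  have h2 : 2 ≤ (n - c) / (k - c) := by
    rw [Nat.le_div_iff_mul_le (by omega)]
    omega
  have hdm := Nat.div_add_mod (n - c) (k - c)
  have h3 : (k - c) * 2 ≤ (k - c) * ((n - c) / (k - c)) := Nat.mul_le_mul_left _ h2
  have hq : 2 ≤ Nat.card F := Finite.one_lt_card
  zify at hq ⊢
  generalize (Nat.card F : ℤ) = q at *
  have hle : q ^ ((n - c) % (k - c) + (k - c)) ≤ q ^ (n - k) :=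
    pow_le_pow_right₀ (by omega) (by omega)
  have hQ : 1 < q ^ (k - c) := one_lt_pow₀ (by omega) (by omega)
  have hmul : q ^ (n - c) = q ^ (n - k) * q ^ (k - c) := by
    rw [← pow_add]
    congr 1
    omega
  rw [hmul] at hcard
  nlinarith

theorem maxIntersectingCard_bounds (hc : c < k) (hn : 3 * k - 1 ≤ n) (hn' : 2 * k ≤ n + c)
    (hq : 4 * n + 9 ≤ Nat.card F)
    (hp : p.Monic) (hirr : Irreducible p) (hd : p.natDegree = k - c)
    (hp' : p'.Monic) (hirr' : Irreducible p') (hd' : p'.natDegree = k - c + (n - c) % (k - c)) :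
    (sunflowerCode hc hn' p p').ncard ≤ maxIntersectingCard F k n c ∧
      (maxIntersectingCard F k n c : ℤ) - (sunflowerCode hc hn' p p').ncard ≤
        (Nat.card F : ℤ) ^ ((n - c) % (k - c)) - 1 := by
  obtain ⟨hcode, hcard⟩ := sunflowerCode_spec hc hn' hp hirr hd hp' hirr' hd'
  have hge := pow_le_ncard_sunflowerCode hc hn' hp hirr hd hp' hirr' hd'
  set f := (sunflowerCode hc hn' p p').ncard
  refine ⟨le_csSup (bddAbove_intersectingCard F k n c) ⟨_, hcode, rfl⟩, ?_⟩
  have hne : {N | ∃ C : Set (Submodule F (Fin n → F)),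
      IsIntersectingCode k c C ∧ C.ncard = N}.Nonempty := ⟨f, _, hcode, rfl⟩
  obtain ⟨C, hC, hCe⟩ := Nat.sSup_mem hne (bddAbove_intersectingCard F k n c)
  rw [maxIntersectingCard, ← hCe]
  have hq1 : 1 ≤ Nat.card F := by omega
  rcases ncard_intersectingCode_le hc hq hC with h | h
  -- This is where `n ≥ 3 * k - 1` enters, as `2 * k - 1 ≤ n - k`.
  · have h1 : C.ncard ≤ f := h.trans ((Nat.pow_le_pow_right hq1 (by omega)).trans hge)
    have h2 : 1 ≤ Nat.card F ^ ((n - c) % (k - c)) := Nat.one_le_pow _ _ hq1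
    zify at h1 h2
    linarith
  · zify [Nat.one_le_pow (k - c) _ hq1, Nat.one_le_pow (n - c) _ hq1] at h
    have hr : (Nat.card F : ℤ) ^ ((n - c) % (k - c)) < (Nat.card F : ℤ) ^ (k - c) :=
      pow_lt_pow_right₀ (by omega) (Nat.mod_lt _ (by omega))
    have hr1 : 1 ≤ (Nat.card F : ℤ) ^ ((n - c) % (k - c)) := one_le_pow₀ (by omega)
    rw [pow_add] at hcard
    -- A gap of at least `q ^ r` would give `q ^ r * (Q - 1) ≤ (q ^ r - 1) * Q`, that is `Q ≤ q ^
    -- r`.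
    by_contra! hcon
    nlinarith

/-- The gap is below `q ^ r`, while the maximum is at least `q ^ (n - k) ≥ q ^ (r + 1)`; the
relative gap is thus at most `1 / q`. -/
theorem one_sub_inv_le_ncard_div (hc : c < k) (hn : 3 * k - 1 ≤ n) (hn' : 2 * k ≤ n + c)
    (hq : 4 * n + 9 ≤ Nat.card F)
    (hp : p.Monic) (hirr : Irreducible p) (hd : p.natDegree = k - c)
    (hp' : p'.Monic) (hirr' : Irreducible p') (hd' : p'.natDegree = k - c + (n - c) % (k - c)) :
    1 - (Nat.card F : ℝ)⁻¹ ≤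
        ((sunflowerCode hc hn' p p').ncard : ℝ) / (maxIntersectingCard F k n c : ℝ) ∧
      ((sunflowerCode hc hn' p p').ncard : ℝ) / (maxIntersectingCard F k n c : ℝ) ≤ 1 := by
  obtain ⟨hle, hdiff⟩ := maxIntersectingCard_bounds hc hn hn' hq hp hirr hd hp' hirr' hd'
  have hge := pow_le_ncard_sunflowerCode hc hn' hp hirr hd hp' hirr' hd'
  have hr : (n - c) % (k - c) < k - c := Nat.mod_lt _ (by omega)
  have hpow : Nat.card F ^ ((n - c) % (k - c) + 1) ≤ Nat.card F ^ (n - k) :=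
    Nat.pow_le_pow_right (by omega) (by omega)
  have hq0 : 0 < Nat.card F := Nat.card_pos
  have hpow0 : 0 < Nat.card F ^ ((n - c) % (k - c) + 1) := pow_pos hq0 _
  set f := (sunflowerCode hc hn' p p').ncard
  generalize maxIntersectingCard F k n c = e at *
  have he : (0 : ℝ) < e := by exact_mod_cast (by omega : 0 < e)
  have hleR : (f : ℝ) ≤ e := by exact_mod_cast hle
  refine ⟨?_, (div_le_one he).2 hleR⟩
  have h1 : (e : ℝ) - f ≤ (Nat.card F : ℝ) ^ ((n - c) % (k - c)) - 1 := by exact_mod_cast hdiff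
  have h2 : (Nat.card F : ℝ) ^ ((n - c) % (k - c) + 1) ≤ e := by
    exact_mod_cast (hpow.trans hge).trans hle
  have hqR : (0 : ℝ) < Nat.card F := by exact_mod_cast hq0
  rw [le_div_iff₀ he, sub_mul, one_mul]
  have h3 : (Nat.card F : ℝ) ^ ((n - c) % (k - c)) ≤ (Nat.card F : ℝ)⁻¹ * e := by
    rw [inv_mul_eq_div, le_div_iff₀ hqR, ← pow_succ]
    exact h2
  linarith

end MaxCard

theorem mainTheorem11 (k n c : ℕ) (hc : c < k) (hn : 3 * k - 1 ≤ n) :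
    (∃ q₀ : ℕ, ∀ (F : Type*) [Field F] [Finite F], q₀ ≤ Nat.card F →
      ∀ p p' : F[X], p.Monic → Irreducible p → p.natDegree = k - c →
        p'.Monic → Irreducible p' → p'.natDegree = k - c + (n - c) % (k - c) →
        (maxIntersectingCard F k n c : ℤ)
            - ((sunflowerCode hc (by omega : 2 * k ≤ n + c) p p').ncard : ℤ)
          ≤ (Nat.card F : ℤ) ^ ((n - c) % (k - c)) - 1) ∧
    (∀ (ι : Type*) (l : Filter ι) (F : ι → Type*) [∀ x, Field (F x)] [∀ x, Finite (F x)]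
      (p p' : ∀ x, (F x)[X]),
      Tendsto (fun x => Nat.card (F x)) l atTop →
      (∀ x, (p x).Monic ∧ Irreducible (p x) ∧ (p x).natDegree = k - c) →
      (∀ x, (p' x).Monic ∧ Irreducible (p' x) ∧
        (p' x).natDegree = k - c + (n - c) % (k - c)) →
      Tendsto
        (fun x => ((sunflowerCode hc (by omega : 2 * k ≤ n + c) (p x) (p' x)).ncard : ℝ)
          / (maxIntersectingCard (F x) k n c : ℝ))
        l (𝓝 1)) := by
  refine ⟨⟨4 * n + 9, fun F _ _ hq p p' hp hirr hd hp' hirr' hd' =>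
    (maxIntersectingCard_bounds hc hn (by omega) hq hp hirr hd hp' hirr' hd').2⟩, ?_⟩
  intro ι l F _ _ p p' hF hp hp'
  have hbounds : ∀ᶠ x in l, 4 * n + 9 ≤ Nat.card (F x) := hF.eventually_ge_atTop _
  have hinv : Tendsto (fun x => 1 - (Nat.card (F x) : ℝ)⁻¹) l (𝓝 1) := by
    simpa using (tendsto_inv_atTop_zero.comp (tendsto_natCast_atTop_atTop.comp hF)).const_sub
      (1 : ℝ)
  refine tendsto_of_tendsto_of_tendsto_of_le_of_le' hinv tendsto_const_nhds ?_ ?_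
  · filter_upwards [hbounds] with x hx
    exact (one_sub_inv_le_ncard_div hc hn (by omega) hx (hp x).1 (hp x).2.1 (hp x).2.2
      (hp' x).1 (hp' x).2.1 (hp' x).2.2).1
  · filter_upwards [hbounds] with x hx
    exact (one_sub_inv_le_ncard_div hc hn (by omega) hx (hp x).1 (hp x).2.1 (hp x).2.2
      (hp' x).1 (hp' x).2.1 (hp' x).2.2).2
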